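/- Let $(\varepsilon_{ij})_{i,j\ge 1}$ be independent random variables with $\Pr(\varepsilon_{ij}=1)=\Pr(\varepsilon_{ij}=0)=\tfrac12$ (the Bernoulli Matching model with $k=2$). Define random variables $\mathbf R_{i,j}$, $i,j\ge 0$ (the model with reach $r=3$), by $\mathbf R_{i,0}=\mathbf R_{0,j}=0$ and, for $i,j\ge 1$, $$\mathbf R_{i,j}=\begin{cases}\mathbf R_{i-1,j-1}+1 & \text{if }\varepsilon_{ij}=1,\\ \max\{\mathbf R_{i,j-1},\mathbf R_{i-1,j}\} & \text{if }\varepsilon_{ij}=0\text{ and }|i-j|<3,\\ \mathbf R_{i,j-1} & \text{if }\varepsilon_{ij}=0\text{ and }j-i\ge 3,\\ \mathbf R_{i-1,j} & \text{if }\varepsilon_{ij}=0\text{ and }i-j\ge 3.\end{cases}$$ Then the limit $\gamma_{2,3}^{B}=\lim_{n\to\infty}\frac{1}{n}\,\mathbb E[\mathbf R_{n,n}]$ exists and $$\gamma_{2,3}^{B}=\frac{3376}{4279}.$$ -/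

import Mathlib

open MeasureTheory ProbabilityTheory Filter Topology

/-- The `r`-reach recurrence on the lattice `ℕ × ℕ`, driven by a `0/1` array `e`.
`e i j` is the indicator of the diagonal bond from `(i, j)` to `(i + 1, j + 1)`: bonds are indexed
by their starting vertex, so `e i j` is the variable usually written `ε_{i+1, j+1}`. -/
def reach (r : ℕ) (e : ℕ → ℕ → Fin 2) : ℕ → ℕ → ℕ
  | 0, _ => 0
  | _ + 1, 0 => 0
  | i + 1, j + 1 =>
    if e i j = 1 then reach r e i j + 1
    else if |((i + 1 : ℕ) : ℤ) - ((j + 1 : ℕ) : ℤ)| < (r : ℤ) then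
      max (reach r e (i + 1) j) (reach r e i (j + 1))
    else if ((j + 1 : ℕ) : ℤ) - ((i + 1 : ℕ) : ℤ) ≥ (r : ℤ) then reach r e (i + 1) j
    else reach r e i (j + 1)
termination_by i j => (i, j)

/-- The Bernoulli Matching model with parameter `k`: the bond indicators `ε i j` are independent
`0/1`-valued random variables, each equal to `1` with probability `1 / k` (and hence equal to `0`
with probability `1 - 1 / k`). -/
structure IsBernoulliMatching {Ω : Type*} [MeasurableSpace Ω] (k : ℕ)
    (ε : ℕ → ℕ → Ω → Fin 2) (μ : Measure Ω) : Prop where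
  measurable : ∀ i j, Measurable (ε i j)
  indep : iIndepFun (fun p : ℕ × ℕ => ε p.1 p.2) μ
  prob_one : ∀ i j, μ.real {ω | ε i j ω = 1} = 1 / (k : ℝ)

/-- The expected value of the `r`-reach value at the lattice point `(n, n)`. -/
noncomputable def expectedReach {Ω : Type*} [MeasurableSpace Ω] (r : ℕ)
    (ε : ℕ → ℕ → Ω → Fin 2) (μ : Measure Ω) (n : ℕ) : ℝ :=
  ∫ ω, (reach r (fun i j => ε i j ω) n n : ℝ) ∂μ

/-!
The value `reach 3 e n n` only involves the values in the strip `|i - j| ≤ 3`. Inside the strip,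
values at neighbouring vertices differ by `0` or `1` (`reach_three_step`), so the six increments
along a zigzag path across the strip form a Markov chain with `64` states as the path is moved along the
diagonal, and the height on the diagonal is an additive functional of this chain. One move
consists of two half-steps, in which the vertices at odd and then those at even distance from the
diagonal are advanced; each uses fresh bonds from a single antidiagonal, and each new increment is
a Boolean function of one bond and at most two old ones (`upperHalfOdd_eq`, `upperHalf_succ`,
`reach_diagonal_succ`).

The drift is found without the stationary distribution: the tables `potential` and `oddPotential`
solve the Poisson equation of the chain (`sum_potential_even`, `sum_potential_odd`), which says that
`4279 * height + potential` grows by exactly `3376` in expectation with every move. Integrating out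
the fresh bonds (`IsBernoulliMatching.integral_block`) turns this into an exact formula for the
expectation (`IsBernoulliMatching.expectedReach_add_potential`). As the potential is bounded, it
disappears after division by `n`, and the limit is `3376 / 4279`.
-/

/-! ### The recurrence -/

theorem reach_zero_right (r : ℕ) (e : ℕ → ℕ → Fin 2) (i : ℕ) : reach r e i 0 = 0 := by
  cases i <;> simp [reach]

theorem reach_zero_left (r : ℕ) (e : ℕ → ℕ → Fin 2) (j : ℕ) : reach r e 0 j = 0 := by
  simp [reach]

theorem reach_three_succ (e : ℕ → ℕ → Fin 2) (i j : ℕ) :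
    reach 3 e (i + 1) (j + 1) =
      if e i j = 1 then reach 3 e i j + 1
      else if i < j + 3 ∧ j < i + 3 then max (reach 3 e (i + 1) j) (reach 3 e i (j + 1))
      else if i + 3 ≤ j then reach 3 e (i + 1) j
      else reach 3 e i (j + 1) := by
  rw [reach]
  have h1 : |((i + 1 : ℕ) : ℤ) - ((j + 1 : ℕ) : ℤ)| < ((3 : ℕ) : ℤ) ↔ i < j + 3 ∧ j < i + 3 := by
    rw [abs_lt]; omega
  have h2 : ((j + 1 : ℕ) : ℤ) - ((i + 1 : ℕ) : ℤ) ≥ ((3 : ℕ) : ℤ) ↔ i + 3 ≤ j := by omega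
  simp only [h1, h2]

theorem reach_three_swap (e : ℕ → ℕ → Fin 2) (i j : ℕ) :
    reach 3 (fun a b => e b a) i j = reach 3 e j i := by
  induction i generalizing j with
  | zero => rw [reach_zero_left, reach_zero_right]
  | succ i ihi =>
    induction j with
    | zero => rw [reach_zero_left, reach_zero_right]
    | succ j ihj =>
      rw [reach_three_succ, reach_three_succ, ihi, ihi, ihj]
      split_ifs <;> first | rfl | omega

/-- Values of the recurrence at a vertex depend only on bonds strictly to its lower left. -/
theorem reach_congr (r : ℕ) {e e' : ℕ → ℕ → Fin 2} (i j : ℕ)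
    (h : ∀ a < i, ∀ b < j, e a b = e' a b) : reach r e i j = reach r e' i j := by
  induction i generalizing j with
  | zero => rw [reach_zero_left, reach_zero_left]
  | succ i ihi =>
    induction j with
    | zero => rw [reach_zero_right, reach_zero_right]
    | succ j ihj =>
      rw [reach, reach, h i (by omega) j (by omega),
        ihi j fun a ha b hb => h a (by omega) b (by omega),
        ihi (j + 1) fun a ha b hb => h a (by omega) b hb,
        ihj fun a ha b hb => h a ha b (by omega)]

theorem reach_le_add (r : ℕ) (e : ℕ → ℕ → Fin 2) (i j : ℕ) : reach r e i j ≤ i + j := by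
  induction i generalizing j with
  | zero => simp [reach_zero_left]
  | succ i ihi =>
    induction j with
    | zero => simp [reach_zero_right]
    | succ j ihj =>
      have h1 := ihi j
      have h2 := ihi (j + 1)
      rw [reach]
      split_ifs <;> omega

theorem measurable_reach (r i j : ℕ) :
    Measurable fun e : ℕ × ℕ → Fin 2 => reach r (fun a b => e (a, b)) i j := by
  induction i generalizing j with
  | zero => simp only [reach_zero_left]; exact measurable_const
  | succ i ihi =>
    induction j with
    | zero => simp only [reach_zero_right]; exact measurable_const
    | succ j ihj =>
      simp only [reach]
      have hs : MeasurableSet {e : ℕ × ℕ → Fin 2 | e (i, j) = 1} :=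
        measurable_pi_apply (i, j) (measurableSet_singleton 1)
      refine Measurable.ite hs ((ihi j).add_const 1) ?_
      split_ifs
      · exact ihj.sup (ihi (j + 1))
      · exact ihj
      · exact ihi (j + 1)

/-- Inside the strip `|i - j| ≤ 3`, a unit step in either direction raises the value by `0` or `1`.
Outside the strip this may fail. -/
theorem reach_three_step (e : ℕ → ℕ → Fin 2) (i j : ℕ) :
    (i + 1 ≤ j + 3 → j ≤ i + 3 →
      reach 3 e (i + 1) j = reach 3 e i j ∨ reach 3 e (i + 1) j = reach 3 e i j + 1) ∧
    (i ≤ j + 3 → j + 1 ≤ i + 3 →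
      reach 3 e i (j + 1) = reach 3 e i j ∨ reach 3 e i (j + 1) = reach 3 e i j + 1) := by
  induction hs : i + j using Nat.strong_induction_on generalizing i j with
  | _ s ih =>
  subst hs
  constructor
  · intro h1 h2
    cases j with
    | zero => simp [reach_zero_right]
    | succ j =>
      have a := (ih (i + j) (by omega) i j rfl).1
      have b := (ih (i + j) (by omega) i j rfl).2
      rw [reach_three_succ]
      split_ifs <;> omega
  · intro h1 h2
    cases i with
    | zero => simp [reach_zero_left]
    | succ i =>
      have a := (ih (i + j) (by omega) i j rfl).1
      have b := (ih (i + j) (by omega) i j rfl).2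
      rw [reach_three_succ]
      split_ifs <;> omega

/-! ### The increment process along the diagonal -/

/-- The increments along the half of a zigzag path across the strip that lies on one side of the
diagonal, listed from the diagonal outwards; `true` stands for an increment of `1`. -/
abbrev Half := Bool × Bool × Bool

/-- The increments along the zigzag through `(n, n)`, `(n - 1, n)`, `(n - 1, n + 1)`,
`(n - 2, n + 1)`, where `n = m + 2`; the shift keeps the last vertex in the quadrant. Each increment
is encoded as whether the value goes up, the vertices being compared in the direction of the order
of the lattice. -/
def upperHalf (e : ℕ → ℕ → Fin 2) (m : ℕ) : Half :=
  (decide (reach 3 e (m + 1) (m + 2) < reach 3 e (m + 2) (m + 2)),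
   decide (reach 3 e (m + 1) (m + 2) < reach 3 e (m + 1) (m + 3)),
   decide (reach 3 e m (m + 3) < reach 3 e (m + 1) (m + 3)))

/-- The increments along the zigzag through `(n, n)`, `(n, n + 1)`, `(n - 1, n + 1)`,
`(n - 1, n + 2)`, where `n = m + 2`: the path of `upperHalf e m` after the vertices at odd distance
from the diagonal have been moved one step along the diagonal. -/
def upperHalfOdd (e : ℕ → ℕ → Fin 2) (m : ℕ) : Half :=
  (decide (reach 3 e (m + 2) (m + 2) < reach 3 e (m + 2) (m + 3)),
   decide (reach 3 e (m + 1) (m + 3) < reach 3 e (m + 2) (m + 3)),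
   decide (reach 3 e (m + 1) (m + 3) < reach 3 e (m + 1) (m + 4)))

/-- The passage from `upperHalf` to `upperHalfOdd`: `x₁` and `x₃` are the bonds pointing to the
new vertices at distance `1` and `3` from the diagonal. -/
def oddUpdate (h : Half) (x₁ x₃ : Fin 2) : Half :=
  let M := decide (x₁ = 1) || h.1 || h.2.1
  (M && !h.1, M && !h.2.1, decide (x₃ = 1) && !h.2.2)

/-- The passage from `upperHalfOdd` to the next `upperHalf`: `M₀` tells whether the value on the
diagonal goes up, and `x₂` is the bond pointing to the new vertex at distance `2`. -/
def evenUpdate (M₀ : Bool) (h : Half) (x₂ : Fin 2) : Half :=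
  let M := decide (x₂ = 1) || h.2.1 || h.2.2
  (M₀ && !h.1, M && !h.2.1, M && !h.2.2)

/-- The rule for one lattice square with values `p` at the lower left, `u` and `v` next to it, and
`q` at the upper right: `q` exceeds `p` exactly when the bond is present or one of the two adjacent
increments is `1`. -/
theorem corner_update {p u v q : ℕ} {x : Fin 2} (hu : u = p ∨ u = p + 1) (hv : v = p ∨ v = p + 1)
    (hq : q = if x = 1 then p + 1 else max u v) :
    q = p + (decide (x = 1) || decide (p < u) || decide (p < v)).toNat ∧
    decide (u < q) = ((decide (x = 1) || decide (p < u) || decide (p < v)) && !decide (p < u)) ∧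
    decide (v < q) = ((decide (x = 1) || decide (p < u) || decide (p < v)) && !decide (p < v)) := by
  subst hq
  by_cases hx : x = 1 <;> rcases hu with rfl | rfl <;> rcases hv with rfl | rfl <;> simp [hx]

theorem upperHalfOdd_eq (e : ℕ → ℕ → Fin 2) (m : ℕ) :
    upperHalfOdd e m = oddUpdate (upperHalf e m) (e (m + 1) (m + 2)) (e m (m + 3)) := by
  have h1 := (reach_three_step e (m + 1) (m + 2)).1 (by omega) (by omega)
  have h2 := (reach_three_step e (m + 1) (m + 2)).2 (by omega) (by omega)
  have h3 := (reach_three_step e m (m + 3)).1 (by omega) (by omega)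
  have hc := corner_update (q := reach 3 e (m + 2) (m + 3)) (x := e (m + 1) (m + 2)) h1 h2
    (by rw [reach_three_succ, if_pos (show _ ∧ _ by omega)])
  -- The outermost vertex does not see its neighbour outside the strip.
  have hb : reach 3 e (m + 1) (m + 4) =
      if e m (m + 3) = 1 then reach 3 e m (m + 3) + 1 else reach 3 e (m + 1) (m + 3) := by
    rw [reach_three_succ, if_neg (show ¬ (_ ∧ _) by omega), if_pos (show _ ≤ _ by omega)]
  refine Prod.ext hc.2.1 (Prod.ext hc.2.2 ?_)
  simp only [upperHalfOdd, oddUpdate, upperHalf, hb]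
  by_cases hx : e m (m + 3) = 1 <;> rcases h3 with h3 | h3 <;> simp [hx, h3]

theorem reach_diagonal_succ (e : ℕ → ℕ → Fin 2) (m : ℕ) :
    let M := decide (e (m + 2) (m + 2) = 1) || (upperHalfOdd e m).1 ||
      (upperHalfOdd (fun a b => e b a) m).1
    reach 3 e (m + 3) (m + 3) = reach 3 e (m + 2) (m + 2) + M.toNat ∧
    decide (reach 3 e (m + 2) (m + 3) < reach 3 e (m + 3) (m + 3)) =
      (M && !(upperHalfOdd e m).1) := by
  have h1 := (reach_three_step e (m + 2) (m + 2)).1 (by omega) (by omega)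
  have h2 := (reach_three_step e (m + 2) (m + 2)).2 (by omega) (by omega)
  have hc := corner_update (q := reach 3 e (m + 3) (m + 3)) (x := e (m + 2) (m + 2)) h2 h1
    (by rw [reach_three_succ, if_pos (show _ ∧ _ by omega), max_comm])
  simp only [upperHalfOdd, reach_three_swap]
  exact ⟨hc.1, hc.2.1⟩

theorem upperHalf_succ (e : ℕ → ℕ → Fin 2) (m : ℕ) :
    upperHalf e (m + 1) = evenUpdate
      (decide (e (m + 2) (m + 2) = 1) || (upperHalfOdd e m).1 ||
        (upperHalfOdd (fun a b => e b a) m).1)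
      (upperHalfOdd e m) (e (m + 1) (m + 3)) := by
  have h1 := (reach_three_step e (m + 1) (m + 3)).1 (by omega) (by omega)
  have h2 := (reach_three_step e (m + 1) (m + 3)).2 (by omega) (by omega)
  have hc := corner_update (q := reach 3 e (m + 2) (m + 4)) (x := e (m + 1) (m + 3)) h1 h2
    (by rw [reach_three_succ, if_pos (show _ ∧ _ by omega)])
  exact Prod.ext (reach_diagonal_succ e m).2 (Prod.ext hc.2.1 hc.2.2)

/-! ### The potential -/

/-- Whether the value on the diagonal goes up, given the two halves of the odd zigzag and the bond
that starts on the diagonal. -/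
def diagonalGain (h h' : Half) (x : Fin 2) : Bool :=
  decide (x = 1) || h.1 || h'.1

/-- The values of `potential`: the solution of the Poisson equation of the increment process,
multiplied by `4279` and normalised to vanish at the all-zero state. -/
def potentialTable : List (List ℤ) :=
  [[0, -242, 2025, 1254, -988, -1024, -386, -724],
   [-242, -512, 1925, 1120, -1374, -1418, -680, -1062],
   [2025, 1925, 3137, 2637, 1693, 1685, 1893, 1765],
   [1254, 1120, 2637, 2040, 794, 782, 1072, 898],
   [-988, -1374, 1693, 794, -2809, -2895, -1678, -2255],
   [-1024, -1418, 1685, 782, -2895, -2985, -1730, -2321],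
   [-386, -680, 1893, 1072, -1678, -1730, -890, -1314],
   [-724, -1062, 1765, 898, -2255, -2321, -1314, -1809]]

/-- The values of `oddPotential`, obtained by averaging `potential` plus `4279` times the gain on
the diagonal over the three bonds of an even update. -/
def oddPotentialTable : List (List ℤ) :=
  [[1567, 2557, 1055, 1187, 4274, 6008, 3061, 3423],
   [2557, 3263, 2237, 2313, 4622, 6172, 3599, 3893],
   [1055, 2237, 391, 571, 4158, 5964, 2861, 3255],
   [1187, 2313, 571, 735, 4182, 5972, 2905, 3291],
   [4274, 4622, 4158, 4182, 5416, 6610, 4718, 4906],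
   [6008, 6172, 5964, 5972, 6610, 7416, 6204, 6304],
   [3061, 3599, 2861, 2905, 4718, 6204, 3767, 4037],
   [3423, 3893, 3255, 3291, 4906, 6304, 4037, 4279]]

/-- The entry of a table at a pair of halves, each read as a three-digit binary number. -/
def lookup (t : List (List ℤ)) (h h' : Half) : ℤ :=
  let code := fun h : Half => 4 * h.1.toNat + 2 * h.2.1.toNat + h.2.2.toNat
  (t.getD (code h) []).getD (code h') 0

/-- The corrector on even zigzags: `4279` times the height on the diagonal plus `potential` grows by
`3376` on average when `n` grows by `1`. -/
def potential : Half → Half → ℤ := lookup potentialTable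

/-- The corrector on the odd zigzags, halfway between two even ones. -/
def oddPotential : Half → Half → ℤ := lookup oddPotentialTable

/-- The Poisson equation for the even half-step; the factor `8` is the number of outcomes of the
three bonds. -/
theorem sum_potential_even (h h' : Half) :
    ∑ x : Fin 3 → Fin 2, (4279 * ((diagonalGain h h' (x 0)).toNat : ℤ) +
      potential (evenUpdate (diagonalGain h h' (x 0)) h (x 1))
        (evenUpdate (diagonalGain h h' (x 0)) h' (x 2))) =
      8 * oddPotential h h' := by
  revert h h'
  decide +kernel

/-- The Poisson equation for the odd half-step, with `16` outcomes of the four bonds. The drift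
`3376` is put into this half-step. -/
theorem sum_potential_odd (h h' : Half) :
    ∑ x : Fin 4 → Fin 2, oddPotential (oddUpdate h (x 0) (x 1)) (oddUpdate h' (x 2) (x 3)) =
      16 * (potential h h' + 3376) := by
  revert h h'
  decide +kernel

/-! ### Averaging over a finite block of bonds -/

namespace IsBernoulliMatching

theorem measurable_array {Ω : Type*} [MeasurableSpace Ω] {k : ℕ} {μ : Measure Ω}
    {ε : ℕ → ℕ → Ω → Fin 2} (hε : IsBernoulliMatching k ε μ) :
    Measurable fun ω => fun q : ℕ × ℕ => ε q.1 q.2 ω :=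
  measurable_pi_iff.2 fun q => hε.measurable q.1 q.2

variable {Ω : Type*} [MeasurableSpace Ω] {μ : Measure Ω} [IsProbabilityMeasure μ]
  {ε : ℕ → ℕ → Ω → Fin 2}

theorem measureReal_eq_half (hε : IsBernoulliMatching 2 ε μ) (i j : ℕ) (x : Fin 2) :
    μ.real {ω | ε i j ω = x} = 1 / 2 := by
  have h1 : μ.real {ω | ε i j ω = 1} = 1 / 2 := by simpa using hε.prob_one i j
  have hs : MeasurableSet {ω | ε i j ω = 1} := hε.measurable i j (measurableSet_singleton 1)
  fin_cases x
  · have hc : {ω | ε i j ω = 0} = {ω | ε i j ω = 1}ᶜ := by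
      ext ω
      simp only [Set.mem_ofPred_eq, Set.mem_compl_iff]
      omega
    change μ.real {ω | ε i j ω = 0} = 1 / 2
    rw [hc, probReal_compl_eq_one_sub hs, h1]
    norm_num
  · exact h1

theorem measureReal_block_eq (hε : IsBernoulliMatching 2 ε μ) {ι : Type*} [Fintype ι]
    {p : ι → ℕ × ℕ} (hp : p.Injective) (x : ι → Fin 2) :
    μ.real {ω | ∀ k, ε (p k).1 (p k).2 ω = x k} = 1 / 2 ^ Fintype.card ι := by
  have h := (hε.indep.precomp hp).measure_inter_preimage_eq_mul Finset.univ
    (sets := fun k => {x k}) fun _ _ => measurableSet_singleton _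
  have hs : {ω | ∀ k, ε (p k).1 (p k).2 ω = x k} =
      ⋂ k ∈ Finset.univ, (fun ω => ε (p k).1 (p k).2 ω) ⁻¹' {x k} := by
    ext ω; simp
  rw [Measure.real, hs, h, ENNReal.toReal_prod]
  calc ∏ k, (μ ((fun ω => ε (p k).1 (p k).2 ω) ⁻¹' {x k})).toReal
      = ∏ _k : ι, (1 / 2 : ℝ) :=
        Finset.prod_congr rfl fun k _ => hε.measureReal_eq_half (p k).1 (p k).2 (x k)
    _ = 1 / 2 ^ Fintype.card ι := by simp

/-- If `F e x` does not depend on the bonds of `e` in the block `p`, then the block may be integrated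
out: inserting it for `x` has the same expectation as averaging over all values of `x`. -/
theorem integral_block (hε : IsBernoulliMatching 2 ε μ) {ι : Type*} [Fintype ι] [DecidableEq ι]
    {p : ι → ℕ × ℕ} (hp : p.Injective) (F : (ℕ × ℕ → Fin 2) → (ι → Fin 2) → ℝ)
    (hF : ∀ x, Measurable fun e => F e x) {C : ℝ} (hC : ∀ e x, |F e x| ≤ C)
    (hdep : ∀ e e' x, (∀ q ∉ Set.range p, e q = e' q) → F e x = F e' x) :
    ∫ ω, F (fun q => ε q.1 q.2 ω) (fun k => ε (p k).1 (p k).2 ω) ∂μ =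
      ∫ ω, (∑ x, F (fun q => ε q.1 q.2 ω) x) / 2 ^ Fintype.card ι ∂μ := by
  classical
  have hFm : ∀ x, Measurable fun ω => F (fun q => ε q.1 q.2 ω) x := fun x =>
    (hF x).comp hε.measurable_array
  have hFi : ∀ x, Integrable (fun ω => F (fun q => ε q.1 q.2 ω) x) μ := fun x =>
    Integrable.of_bound (hFm x).aestronglyMeasurable C (ae_of_all _ fun ω => hC _ x)
  let A : (ι → Fin 2) → Set Ω := fun x => {ω | ∀ k, ε (p k).1 (p k).2 ω = x k}
  let m : ℕ × ℕ → MeasurableSpace Ω := fun q =>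
    MeasurableSpace.comap (fun ω => ε q.1 q.2 ω) inferInstance
  have hm : ∀ q, m q ≤ ‹MeasurableSpace Ω› := fun q => (hε.measurable q.1 q.2).comap_le
  have hcoord : ∀ (S : Set (ℕ × ℕ)) (q), q ∈ S →
      Measurable[⨆ i ∈ S, m i] fun ω => ε q.1 q.2 ω := fun S q hq =>
    (comap_measurable _).mono (le_iSup₂_of_le q hq le_rfl) le_rfl
  have hA' : ∀ x, MeasurableSet[⨆ i ∈ Set.range p, m i] (A x) := fun x => by
    have : A x = ⋂ k, (fun ω => ε (p k).1 (p k).2 ω) ⁻¹' {x k} := by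
      ext ω; simp [A]
    rw [this]
    exact MeasurableSet.iInter fun k =>
      hcoord _ (p k) (Set.mem_range_self k) (measurableSet_singleton (x k))
  have hA : ∀ x, MeasurableSet (A x) := fun x => iSup₂_le (fun q _ => hm q) _ (hA' x)
  -- Setting the bonds of the block to `0` does not change `F`, hence `F` is measurable with respect
  -- to the remaining bonds.
  have hF' : ∀ x, Measurable[⨆ i ∈ (Set.range p)ᶜ, m i] fun ω => F (fun q => ε q.1 q.2 ω) x := by
    intro x
    have heq : (fun ω => F (fun q => ε q.1 q.2 ω) x) =
        fun ω => F (fun q => if q ∈ Set.range p then 0 else ε q.1 q.2 ω) x :=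
      funext fun ω => hdep _ _ _ fun q hq => by simp only [if_neg hq]
    rw [heq]
    have hcut : ∀ q, Measurable[⨆ i ∈ (Set.range p)ᶜ, m i]
        fun ω => if q ∈ Set.range p then 0 else ε q.1 q.2 ω := by
      intro q
      by_cases hq : q ∈ Set.range p
      · simp only [if_pos hq]; exact @measurable_const _ _ _ (_) _
      · simp only [if_neg hq]; exact hcoord _ q hq
    exact (hF x).comp ((@measurable_pi_iff _ _ _ (_) _ _).2 hcut)
  have hind := indep_iSup_of_disjoint hm hε.indep (disjoint_compl_right (a := Set.range p))
  have hterm : ∀ x, ∫ ω, (A x).indicator (fun _ => (1 : ℝ)) ω * F (fun q => ε q.1 q.2 ω) x ∂μ =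
      (1 / 2 ^ Fintype.card ι) * ∫ ω, F (fun q => ε q.1 q.2 ω) x ∂μ := by
    intro x
    have hI : IndepFun ((A x).indicator fun _ => (1 : ℝ))
        (fun ω => F (fun q => ε q.1 q.2 ω) x) μ := by
      rw [IndepFun_iff_Indep]
      refine indep_of_indep_of_le_left (indep_of_indep_of_le_right hind (hF' x).comap_le) ?_
      exact Measurable.comap_le (measurable_const.indicator (hA' x))
    rw [hI.integral_fun_mul_eq_mul_integral
      (measurable_const.indicator (hA x)).aestronglyMeasurable (hFm x).aestronglyMeasurable,
      integral_indicator_const _ (hA x), hε.measureReal_block_eq hp x, smul_eq_mul, mul_one]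
  have hsplit : ∀ ω, F (fun q => ε q.1 q.2 ω) (fun k => ε (p k).1 (p k).2 ω) =
      ∑ x, (A x).indicator (fun _ => (1 : ℝ)) ω * F (fun q => ε q.1 q.2 ω) x := by
    intro ω
    rw [Finset.sum_eq_single fun k => ε (p k).1 (p k).2 ω]
    · simp [A]
    · intro x _ hx
      have : ω ∉ A x := fun h => hx (funext fun k => (h k).symm)
      simp [this]
    · simp
  simp only [hsplit]
  rw [integral_finsetSum _ fun x _ => ?_, integral_div, integral_finsetSum _ fun x _ => hFi x,
    Finset.sum_congr rfl fun x _ => hterm x, ← Finset.mul_sum]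
  · ring
  · exact (hFi x).bdd_mul (c := 1) (measurable_const.indicator (hA x)).aestronglyMeasurable
      (ae_of_all _ fun ω => by
        by_cases h : ω ∈ A x <;> simp [h])

end IsBernoulliMatching

/-! ### Dependence on antidiagonals and measurability -/

theorem reach_congr_of_antidiagonal (r : ℕ) {e e' : ℕ → ℕ → Fin 2} {s i j : ℕ}
    (h : ∀ a b, a + b < s → e a b = e' a b) (hs : i + j ≤ s + 1) :
    reach r e i j = reach r e' i j :=
  reach_congr r i j fun a ha b hb => h a b (by omega)

theorem upperHalf_congr {e e' : ℕ → ℕ → Fin 2} {m : ℕ}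
    (h : ∀ a b, a + b < 2 * m + 3 → e a b = e' a b) : upperHalf e m = upperHalf e' m := by
  simp only [upperHalf]
  rw [reach_congr_of_antidiagonal 3 h (i := m + 1) (j := m + 2) (by omega),
    reach_congr_of_antidiagonal 3 h (i := m + 2) (j := m + 2) (by omega),
    reach_congr_of_antidiagonal 3 h (i := m + 1) (j := m + 3) (by omega),
    reach_congr_of_antidiagonal 3 h (i := m) (j := m + 3) (by omega)]

theorem upperHalfOdd_congr {e e' : ℕ → ℕ → Fin 2} {m : ℕ}
    (h : ∀ a b, a + b < 2 * m + 4 → e a b = e' a b) : upperHalfOdd e m = upperHalfOdd e' m := by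
  simp only [upperHalfOdd]
  rw [reach_congr_of_antidiagonal 3 h (i := m + 2) (j := m + 2) (by omega),
    reach_congr_of_antidiagonal 3 h (i := m + 2) (j := m + 3) (by omega),
    reach_congr_of_antidiagonal 3 h (i := m + 1) (j := m + 3) (by omega),
    reach_congr_of_antidiagonal 3 h (i := m + 1) (j := m + 4) (by omega)]

theorem measurable_decide_reach_lt (r i j k l : ℕ) :
    Measurable fun e : ℕ × ℕ → Fin 2 =>
      decide (reach r (fun a b => e (a, b)) i j < reach r (fun a b => e (a, b)) k l) :=
  (measurable_of_countable fun p : ℕ × ℕ => decide (p.1 < p.2)).comp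
    ((measurable_reach r i j).prodMk (measurable_reach r k l))

theorem measurable_upperHalf (m : ℕ) :
    Measurable fun e : ℕ × ℕ → Fin 2 => upperHalf (fun a b => e (a, b)) m :=
  (measurable_decide_reach_lt _ _ _ _ _).prodMk
    ((measurable_decide_reach_lt _ _ _ _ _).prodMk (measurable_decide_reach_lt _ _ _ _ _))

theorem measurable_upperHalfOdd (m : ℕ) :
    Measurable fun e : ℕ × ℕ → Fin 2 => upperHalfOdd (fun a b => e (a, b)) m :=
  (measurable_decide_reach_lt _ _ _ _ _).prodMk
    ((measurable_decide_reach_lt _ _ _ _ _).prodMk (measurable_decide_reach_lt _ _ _ _ _))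

theorem measurable_transpose :
    Measurable fun (e : ℕ × ℕ → Fin 2) (q : ℕ × ℕ) => e (q.2, q.1) :=
  measurable_pi_iff.2 fun _ => measurable_pi_apply _

/-- The state of the increment process on both sides of the diagonal; the lower side is the upper
side of the transposed array. -/
def evenHalves (m : ℕ) (e : ℕ × ℕ → Fin 2) : Half × Half :=
  (upperHalf (fun a b => e (a, b)) m, upperHalf (fun a b => e (b, a)) m)

/-- The state of the increment process halfway between two even zigzags. -/
def oddHalves (m : ℕ) (e : ℕ × ℕ → Fin 2) : Half × Half :=
  (upperHalfOdd (fun a b => e (a, b)) m, upperHalfOdd (fun a b => e (b, a)) m)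

theorem measurable_evenHalves (m : ℕ) : Measurable (evenHalves m) :=
  (measurable_upperHalf m).prodMk ((measurable_upperHalf m).comp measurable_transpose)

theorem measurable_oddHalves (m : ℕ) : Measurable (oddHalves m) :=
  (measurable_upperHalfOdd m).prodMk ((measurable_upperHalfOdd m).comp measurable_transpose)

theorem evenHalves_congr {e e' : ℕ × ℕ → Fin 2} {m : ℕ}
    (h : ∀ q : ℕ × ℕ, q.1 + q.2 < 2 * m + 3 → e q = e' q) : evenHalves m e = evenHalves m e' :=
  Prod.ext (upperHalf_congr fun a b hab => h (a, b) hab)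
    (upperHalf_congr fun a b hab => h (b, a) ((add_comm b a).trans_lt hab))

theorem oddHalves_congr {e e' : ℕ × ℕ → Fin 2} {m : ℕ}
    (h : ∀ q : ℕ × ℕ, q.1 + q.2 < 2 * m + 4 → e q = e' q) : oddHalves m e = oddHalves m e' :=
  Prod.ext (upperHalfOdd_congr fun a b hab => h (a, b) hab)
    (upperHalfOdd_congr fun a b hab => h (b, a) ((add_comm b a).trans_lt hab))

/-! ### The two half-steps -/

/-- The bonds used by an even half-step; all start on the antidiagonal `a + b = 2 * m + 4`. -/
def evenBonds (m : ℕ) : Fin 3 → ℕ × ℕ := ![(m + 2, m + 2), (m + 1, m + 3), (m + 3, m + 1)]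

/-- The bonds used by an odd half-step; all start on the antidiagonal `a + b = 2 * m + 3`. -/
def oddBonds (m : ℕ) : Fin 4 → ℕ × ℕ := ![(m + 1, m + 2), (m, m + 3), (m + 2, m + 1), (m + 3, m)]

theorem evenBonds_injective (m : ℕ) : (evenBonds m).Injective := by
  intro a b h
  fin_cases a <;> fin_cases b <;> simp [evenBonds] at h ⊢

theorem oddBonds_injective (m : ℕ) : (oddBonds m).Injective := by
  intro a b h
  fin_cases a <;> fin_cases b <;> simp [oddBonds] at h ⊢

theorem evenBonds_add (m : ℕ) (k : Fin 3) : (evenBonds m k).1 + (evenBonds m k).2 = 2 * m + 4 := by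
  fin_cases k <;> simp [evenBonds] <;> ring

theorem oddBonds_add (m : ℕ) (k : Fin 4) : (oddBonds m k).1 + (oddBonds m k).2 = 2 * m + 3 := by
  fin_cases k <;> simp [oddBonds] <;> ring

theorem oddHalves_eq (m : ℕ) (e : ℕ × ℕ → Fin 2) :
    oddHalves m e =
      (oddUpdate (evenHalves m e).1 (e (oddBonds m 0)) (e (oddBonds m 1)),
        oddUpdate (evenHalves m e).2 (e (oddBonds m 2)) (e (oddBonds m 3))) :=
  Prod.ext (upperHalfOdd_eq _ m) (upperHalfOdd_eq (fun a b => e (b, a)) m)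

theorem reach_diagonal_succ_eq (m : ℕ) (e : ℕ × ℕ → Fin 2) :
    reach 3 (fun a b => e (a, b)) (m + 3) (m + 3) =
      reach 3 (fun a b => e (a, b)) (m + 2) (m + 2) +
        (diagonalGain (oddHalves m e).1 (oddHalves m e).2 (e (evenBonds m 0))).toNat :=
  (reach_diagonal_succ (fun a b => e (a, b)) m).1

theorem evenHalves_succ (m : ℕ) (e : ℕ × ℕ → Fin 2) :
    evenHalves (m + 1) e =
      let M := diagonalGain (oddHalves m e).1 (oddHalves m e).2 (e (evenBonds m 0))
      (evenUpdate M (oddHalves m e).1 (e (evenBonds m 1)),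
        evenUpdate M (oddHalves m e).2 (e (evenBonds m 2))) := by
  refine Prod.ext (upperHalf_succ (fun a b => e (a, b)) m) ?_
  refine (upperHalf_succ (fun a b => e (b, a)) m).trans ?_
  simp only [diagonalGain, oddHalves, Bool.or_right_comm]
  rfl

/-! ### Expectations -/

namespace IsBernoulliMatching

variable {Ω : Type*} [MeasurableSpace Ω] {μ : Measure Ω} [IsProbabilityMeasure μ]
  {ε : ℕ → ℕ → Ω → Fin 2}

/-- `integral_block` for a block of bonds on one antidiagonal and a state `H` determined by the
earlier antidiagonals. -/
theorem integral_antidiagonal (hε : IsBernoulliMatching 2 ε μ) {ι : Type*} [Fintype ι]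
    [DecidableEq ι] {p : ι → ℕ × ℕ} (hp : p.Injective) {s : ℕ}
    (hps : ∀ k, (p k).1 + (p k).2 = s) {n : ℕ} (hn : n + n ≤ s + 1)
    {H : (ℕ × ℕ → Fin 2) → Half × Half} (hH : Measurable H)
    (hdep : ∀ e e', (∀ q : ℕ × ℕ, q.1 + q.2 < s → e q = e' q) → H e = H e')
    (g : Half × Half → (ι → Fin 2) → ℝ) :
    ∫ ω, ((4279 * reach 3 (fun i j => ε i j ω) n n : ℝ) +
        g (H fun q => ε q.1 q.2 ω) (fun k => ε (p k).1 (p k).2 ω)) ∂μ =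
      ∫ ω, ((4279 * reach 3 (fun i j => ε i j ω) n n : ℝ) +
        (∑ x, g (H fun q => ε q.1 q.2 ω) x) / 2 ^ Fintype.card ι) ∂μ := by
  obtain ⟨B, hB⟩ := Finite.exists_le fun y : (Half × Half) × (ι → Fin 2) => |g y.1 y.2|
  have h := hε.integral_block hp
    (fun e x => (4279 * reach 3 (fun i j => e (i, j)) n n : ℝ) + g (H e) x)
    (fun x => ((measurable_of_countable fun k : ℕ => (4279 * k : ℝ)).comp
      (measurable_reach 3 n n)).add ((measurable_of_countable fun h => g h x).comp hH))
    (C := 4279 * (n + n) + B)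
    (fun e x => by
      have h1 : (reach 3 (fun i j => e (i, j)) n n : ℝ) ≤ n + n := by
        exact_mod_cast reach_le_add 3 (fun i j => e (i, j)) n n
      have h2 := hB (H e, x)
      refine (abs_add_le _ _).trans (add_le_add ?_ h2)
      rw [abs_of_nonneg (by positivity)]
      linarith)
    (fun e e' x he => by
      have he' : ∀ q : ℕ × ℕ, q.1 + q.2 < s → e q = e' q := by
        refine fun q hq => he q ?_
        rintro ⟨k, rfl⟩
        exact absurd (hps k) hq.ne
      rw [hdep e e' he', reach_congr_of_antidiagonal 3 (fun a b hab => he' (a, b) hab) hn])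
  refine h.trans (integral_congr_ae (ae_of_all _ fun ω => ?_))
  simp only [Finset.sum_add_distrib, Finset.sum_const, Finset.card_univ, Fintype.card_fun,
    Fintype.card_fin, add_div, nsmul_eq_mul]
  push_cast
  rw [mul_div_cancel_left₀ _ (by positivity)]

theorem integral_even (hε : IsBernoulliMatching 2 ε μ) (m : ℕ) :
    ∫ ω, ((4279 * reach 3 (fun i j => ε i j ω) (m + 3) (m + 3) : ℝ) +
        potential (evenHalves (m + 1) fun q => ε q.1 q.2 ω).1
          (evenHalves (m + 1) fun q => ε q.1 q.2 ω).2) ∂μ =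
      ∫ ω, ((4279 * reach 3 (fun i j => ε i j ω) (m + 2) (m + 2) : ℝ) +
        oddPotential (oddHalves m fun q => ε q.1 q.2 ω).1
          (oddHalves m fun q => ε q.1 q.2 ω).2) ∂μ := by
  have h := hε.integral_antidiagonal (evenBonds_injective m) (evenBonds_add m) (n := m + 2)
    (by omega) (measurable_oddHalves m)
    (fun e e' he => oddHalves_congr he)
    (fun H x => ((4279 * ((diagonalGain H.1 H.2 (x 0)).toNat : ℤ) +
      potential (evenUpdate (diagonalGain H.1 H.2 (x 0)) H.1 (x 1))
        (evenUpdate (diagonalGain H.1 H.2 (x 0)) H.2 (x 2)) : ℤ) : ℝ))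
  convert h using 3 with ω ω
  · have h1 := reach_diagonal_succ_eq m fun q => ε q.1 q.2 ω
    have h2 := evenHalves_succ m fun q => ε q.1 q.2 ω
    dsimp only at h1 h2
    rw [h1, h2]
    push_cast
    ring
  · rw [← Int.cast_sum, sum_potential_even]
    push_cast
    norm_num

theorem integral_odd (hε : IsBernoulliMatching 2 ε μ) (m : ℕ) :
    ∫ ω, ((4279 * reach 3 (fun i j => ε i j ω) (m + 2) (m + 2) : ℝ) +
        oddPotential (oddHalves m fun q => ε q.1 q.2 ω).1
          (oddHalves m fun q => ε q.1 q.2 ω).2) ∂μ =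
      ∫ ω, ((4279 * reach 3 (fun i j => ε i j ω) (m + 2) (m + 2) : ℝ) +
        potential (evenHalves m fun q => ε q.1 q.2 ω).1
          (evenHalves m fun q => ε q.1 q.2 ω).2 + 3376) ∂μ := by
  have h := hε.integral_antidiagonal (oddBonds_injective m) (oddBonds_add m) (n := m + 2)
    (by omega) (measurable_evenHalves m)
    (fun e e' he => evenHalves_congr he)
    (fun H x => ((oddPotential (oddUpdate H.1 (x 0) (x 1)) (oddUpdate H.2 (x 2) (x 3)) : ℤ) : ℝ))
  convert h using 3 with ω ω
  · rw [oddHalves_eq]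
  · rw [← Int.cast_sum, sum_potential_odd, add_assoc]
    push_cast
    norm_num

theorem integrable_reach (hε : IsBernoulliMatching 2 ε μ) (n : ℕ) :
    Integrable (fun ω => (reach 3 (fun i j => ε i j ω) n n : ℝ)) μ := by
  have hm : Measurable fun ω => reach 3 (fun i j => ε i j ω) n n :=
    (measurable_reach 3 n n).comp hε.measurable_array
  refine Integrable.of_bound ((measurable_of_countable (Nat.cast : ℕ → ℝ)).comp
    hm).aestronglyMeasurable (n + n) (ae_of_all _ fun ω => ?_)
  rw [Real.norm_of_nonneg (by positivity)]
  exact_mod_cast reach_le_add 3 _ n n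

theorem integrable_potential (hε : IsBernoulliMatching 2 ε μ) (m : ℕ) :
    Integrable (fun ω => (potential (evenHalves m fun q => ε q.1 q.2 ω).1
      (evenHalves m fun q => ε q.1 q.2 ω).2 : ℝ)) μ := by
  obtain ⟨B, hB⟩ := Finite.exists_le fun y : Half × Half => ‖(potential y.1 y.2 : ℝ)‖
  exact Integrable.of_bound ((measurable_of_countable fun y : Half × Half =>
    (potential y.1 y.2 : ℝ)).comp ((measurable_evenHalves m).comp
      hε.measurable_array)).aestronglyMeasurable B (ae_of_all _ fun ω => hB _)

/-- The quantity `4279 * height + potential` has expectation exactly linear in `n`. -/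
theorem expectedReach_add_potential (hε : IsBernoulliMatching 2 ε μ) (m : ℕ) :
    4279 * expectedReach 3 ε μ (m + 2) +
        ∫ ω, (potential (evenHalves m fun q => ε q.1 q.2 ω).1
          (evenHalves m fun q => ε q.1 q.2 ω).2 : ℝ) ∂μ =
      4279 * expectedReach 3 ε μ 2 +
        ∫ ω, (potential (evenHalves 0 fun q => ε q.1 q.2 ω).1
          (evenHalves 0 fun q => ε q.1 q.2 ω).2 : ℝ) ∂μ + 3376 * m := by
  induction m with
  | zero => simp
  | succ m ih =>
    have h := (hε.integral_even m).trans (hε.integral_odd m)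
    have hsplit : ∀ n k, Integrable (fun ω => (4279 * reach 3 (fun i j => ε i j ω) n n : ℝ) +
        potential (evenHalves k fun q => ε q.1 q.2 ω).1
          (evenHalves k fun q => ε q.1 q.2 ω).2) μ := fun n k =>
      ((hε.integrable_reach n).const_mul _).add (hε.integrable_potential k)
    rw [integral_add (hsplit _ _) (integrable_const _),
      integral_add ((hε.integrable_reach _).const_mul _) (hε.integrable_potential _),
      integral_add ((hε.integrable_reach _).const_mul _) (hε.integrable_potential _),
      integral_const_mul, integral_const_mul, integral_const, probReal_univ, one_smul] at h
    simp only [expectedReach] at ih ⊢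
    push_cast
    linarith

end IsBernoulliMatching

theorem mainTheorem5 {Ω : Type*} [MeasurableSpace Ω] (μ : Measure Ω) [IsProbabilityMeasure μ]
    (ε : ℕ → ℕ → Ω → Fin 2) (hε : IsBernoulliMatching 2 ε μ) :
    Tendsto (fun n : ℕ => expectedReach 3 ε μ n / (n : ℝ)) atTop (𝓝 (3376 / 4279)) := by
  obtain ⟨B, hB⟩ := Finite.exists_le fun y : Half × Half => ‖(potential y.1 y.2 : ℝ)‖
  let P : ℕ → ℝ := fun m => ∫ ω, (potential (evenHalves m fun q => ε q.1 q.2 ω).1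
    (evenHalves m fun q => ε q.1 q.2 ω).2 : ℝ) ∂μ
  have hP : ∀ m, |P m| ≤ B := fun m => by
    have := norm_integral_le_of_norm_le_const (μ := μ) (C := B)
      (f := fun ω => (potential (evenHalves m fun q => ε q.1 q.2 ω).1
        (evenHalves m fun q => ε q.1 q.2 ω).2 : ℝ)) (ae_of_all _ fun ω => hB _)
    simpa using this
  have hrec : ∀ m, 4279 * expectedReach 3 ε μ (m + 2) + P m =
      4279 * expectedReach 3 ε μ 2 + P 0 + 3376 * m := hε.expectedReach_add_potential
  set D : ℝ := |4279 * expectedReach 3 ε μ 2 - 2 * 3376| + 2 * B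
  have hbound : ∀ n : ℕ, 2 ≤ n → |expectedReach 3 ε μ n / n - 3376 / 4279| ≤ D / n := by
    intro n hn
    obtain ⟨m, rfl⟩ := Nat.exists_eq_add_of_le' hn
    have hpos : (0 : ℝ) < (m + 2 : ℕ) := by positivity
    have heq : expectedReach 3 ε μ (m + 2) / (m + 2 : ℕ) - 3376 / 4279 =
        ((4279 * expectedReach 3 ε μ 2 - 2 * 3376) + P 0 - P m) / 4279 / (m + 2 : ℕ) := by
      have := hrec m
      field_simp
      push_cast
      linarith
    rw [heq, abs_div, abs_of_pos hpos]
    gcongr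
    rw [abs_div, abs_of_pos (by norm_num : (0 : ℝ) < 4279)]
    refine (div_le_self (abs_nonneg _) (by norm_num)).trans ?_
    calc |4279 * expectedReach 3 ε μ 2 - 2 * 3376 + P 0 - P m|
        ≤ |4279 * expectedReach 3 ε μ 2 - 2 * 3376| + |P 0| + |P m| :=
          (abs_sub _ _).trans (add_le_add_left (abs_add_le _ _) _)
      _ ≤ D := by linarith [hP 0, hP m]
  rw [tendsto_iff_norm_sub_tendsto_zero]
  refine squeeze_zero' (Eventually.of_forall fun _ => norm_nonneg _)
    ((eventually_ge_atTop 2).mono fun n hn => ?_) (tendsto_const_div_atTop_nhds_zero_nat D)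
  exact hbound n hn
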